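/- Let $d\ge 0$, $A\subset\mathbb{R}^d$, and let $\tau_x(R)$, $x\in A$, $R\ge 0$, be a real-valued function. Let $B_R(x)$ denote the closed Euclidean ball of radius $R$ centred at $x$, and let $\mathcal{F}$ be the family of all closed subsets of $\mathbb{R}^d$ (including $\emptyset$), equipped with the $\sigma$-algebra generated by the families $\{F\in\mathcal{F}: F\cap K\ne\emptyset\}$, $K\subset\mathbb{R}^d$ compact. A random closed set is a random element $\xi$ of $\mathcal{F}$. Then there exists a random closed set $\xi$ (on some probability space) such that $$\tau_x(R)=\mathbf{P}\{\xi\cap B_R(x)\neq\emptyset\}\qquad\text{for all }x\in A,\ R\ge 0,$$ if and only if the following three conditions hold: (i) $\tau_x(R)\in[0,1]$ for all $x\in A$ and $R\ge 0$; (ii) for every $x\in A$ the function $R\mapsto\tau_x(R)$ is right-continuous on $[0,\infty)$; (iii) $\sum_{i=1}^m a_i\tau_{x_i}(R_i)\ge 0$ for all $m\ge 1$, $a_1,\dots,a_m\in\mathbb{R}$, $x_1,\dots,x_m\in A$ and $R_1,\dots,R_m\ge 0$ such that $\sum_{i=1}^m a_i\mathbf{1}_{B_{R_i}(x_i)\cap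 F\neq\emptyset}\ge 0$ for every $F\in\mathcal{F}$. -/

import Mathlib

open MeasureTheory TopologicalSpace
open scoped NNReal

noncomputable section

/-- The family of all closed sets `F` (the empty set included) that hit `K`. -/
def hitting {X : Type*} [TopologicalSpace X] (K : Set X) : Set (Closeds X) :=
  {F | ((F : Set X) ∩ K).Nonempty}

/-- The Effros σ-algebra on the family of closed subsets of `X`, generated by the families
`{F | F ∩ K ≠ ∅}` for all compact sets `K`. -/
@[reducible] def effros (X : Type*) [TopologicalSpace X] : MeasurableSpace (Closeds X) :=
  MeasurableSpace.generateFrom {H | ∃ K : Set X, IsCompact K ∧ H = hitting K}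

/-- A random closed set: a map into the closed sets that is measurable for the
Effros σ-algebra. -/
def IsRandomClosedSet {X : Type*} [TopologicalSpace X] {Ω : Type*} [mΩ : MeasurableSpace Ω]
    (ξ : Ω → Closeds X) : Prop :=
  @Measurable Ω (Closeds X) mΩ (effros X) ξ

/-- The capacity functional `T(K) = P{ξ ∩ K ≠ ∅}` of the random closed set `ξ`. -/
def capacityFunctional {X : Type*} [TopologicalSpace X] {Ω : Type*} [MeasurableSpace Ω]
    (P : Measure Ω) (ξ : Ω → Closeds X) (K : Set X) : ℝ :=
  P.real {ω | ((ξ ω : Set X) ∩ K).Nonempty}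

/-- `τ` is realisable by a random closed set `ξ` in `ℝ^d`, on some probability space, as its
capacity functional on the closed balls with centres in `A`:
`τ_x(R) = T(B_R(x))` for all `x ∈ A`, `R ≥ 0`. -/
def IsBallRealisable {d : ℕ} (A : Set (EuclideanSpace ℝ (Fin d))) (τ : A → ℝ≥0 → ℝ) : Prop :=
  ∃ (Ω : Type) (_ : MeasurableSpace Ω) (P : Measure Ω)
    (ξ : Ω → Closeds (EuclideanSpace ℝ (Fin d))),
    IsProbabilityMeasure P ∧ IsRandomClosedSet ξ ∧
      ∀ (x : A) (R : ℝ≥0),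
        capacityFunctional P ξ (Metric.closedBall (x : EuclideanSpace ℝ (Fin d)) R) = τ x R

/-- The indicator `1_{K ∩ F ≠ ∅}` as a function of the closed set `F`. -/
def hitIndicator {X : Type*} [TopologicalSpace X] (K : Set X) (F : Closeds X) : ℝ :=
  (hitting K).indicator (fun _ => 1) F

end

/-! Necessity: integrate the pointwise inequality, and use continuity from above, since a closed set
meeting every slightly larger ball meets the ball. Sufficiency: label each set of a countable basis
by whether F hits it. This codes closed sets in a compact Cantor space, but ball indicators need not
be continuous in the code, so Riesz–Markov does not apply to them directly. Instead the functional
sending ball indicators to `τ` is extended positively to continuous functions of the code as well,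
and Riesz–Markov on these gives a measure `μ`. Approximating an open set from inside,
`exists_isProbabilityMeasure_open_le` bounds its `μ`-mass by the value of any combination dominating
its indicator on codes. Decoding makes `μ` the law of a closed set: missing a ball is an open event,
so the hitting probability is at least `τ`; hitting it implies an open event dominated by any larger
ball, and right-continuity gives the other bound. -/

/-! ### Positive extension and Riesz–Markov -/

section Extension

variable {Y ι Ω : Type*} [TopologicalSpace Ω] [CompactSpace Ω]

/-- A linear functional that is positive on the span of the constants and a family of functions
on `Y` extends positively to the continuous functions on a compact space into which `Y` maps. -/
theorem exists_linearMap_extension (w : Y → Ω) (g : ι → Y → ℝ) (t : ι → ℝ)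
    (h : ∀ (b : ℝ) (c : ι →₀ ℝ), (∀ y, 0 ≤ b + Finsupp.linearCombination ℝ g c y) →
      0 ≤ b + Finsupp.linearCombination ℝ t c) :
    ∃ Λ : C(Ω, ℝ) →ₗ[ℝ] ℝ, ∀ (f : C(Ω, ℝ)) (b : ℝ) (c : ι →₀ ℝ),
      (∀ y, 0 ≤ f (w y) + (b + Finsupp.linearCombination ℝ g c y)) →
        0 ≤ Λ f + (b + Finsupp.linearCombination ℝ t c) := by
  let s : PointedCone ℝ (C(Ω, ℝ) × ℝ × (ι →₀ ℝ)) :=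
    { carrier := {p | ∀ y, 0 ≤ p.1 (w y) + (p.2.1 + Finsupp.linearCombination ℝ g p.2.2 y)}
      add_mem' := by
        intro p q hp hq y
        have h₁ := hp y
        have h₂ := hq y
        simp only [Prod.fst_add, Prod.snd_add, ContinuousMap.add_apply, map_add, Pi.add_apply]
        linarith
      zero_mem' := by intro y; simp
      smul_mem' := by
        intro r p hp y
        have h₁ := mul_nonneg r.2 (hp y)
        have h₂ : r • p = (r : ℝ) • p := rfl
        simp only [h₂, Prod.smul_fst, Prod.smul_snd, ContinuousMap.smul_apply, map_smul,
          Pi.smul_apply, smul_eq_mul]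
        linarith }
  let T : C(Ω, ℝ) × ℝ × (ι →₀ ℝ) →ₗ[ℝ] ℝ :=
    (LinearMap.fst ℝ ℝ (ι →₀ ℝ) +
      (Finsupp.linearCombination ℝ t).comp (LinearMap.snd ℝ ℝ (ι →₀ ℝ))).comp
        (LinearMap.snd ℝ C(Ω, ℝ) (ℝ × (ι →₀ ℝ)))
  let D : Submodule ℝ (C(Ω, ℝ) × ℝ × (ι →₀ ℝ)) := Submodule.prod ⊥ ⊤
  obtain ⟨Ψ, hΨD, hΨs⟩ := riesz_extension s ⟨D, T.domRestrict D⟩ (by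
      rintro ⟨⟨f, b, c⟩, hD⟩ hs
      have hf : f = 0 := (Submodule.mem_prod.1 hD).1
      subst hf
      refine h b c fun y => ?_
      simpa using hs y) (by
      -- Cofinality: adding the constant `‖f‖` makes any continuous `f` nonnegative.
      rintro ⟨f, b, c⟩
      refine ⟨⟨(0, ‖f‖ - b, -c), by simp [D]⟩, fun y => ?_⟩
      have := (abs_le.1 (f.norm_coe_le_norm (w y))).1
      simp only [Prod.mk_add_mk, zero_add, sub_add_cancel, neg_add_cancel, map_zero,
        Pi.zero_apply, add_zero]
      linarith)
  refine ⟨Ψ.comp (LinearMap.inl ℝ _ _), fun f b c hf => ?_⟩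
  have h₁ := hΨs (f, b, c) hf
  have h₂ := hΨD ⟨(0, b, c), by simp [D]⟩
  have h₃ : (f, b, c) = (f, 0, 0) + ((0, b, c) : C(Ω, ℝ) × ℝ × (ι →₀ ℝ)) := by simp
  rw [h₃, map_add, h₂] at h₁
  exact h₁

variable [T2Space Ω] [MeasurableSpace Ω] [BorelSpace Ω]

/-- A positive functional on the span of the constants and a family of functions on `Y` is
dominated, on open sets, by a probability measure on a compact space into which `Y` maps. -/
theorem exists_isProbabilityMeasure_open_le (w : Y → Ω) (g : ι → Y → ℝ) (t : ι → ℝ)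
    (h : ∀ (b : ℝ) (c : ι →₀ ℝ), (∀ y, 0 ≤ b + Finsupp.linearCombination ℝ g c y) →
      0 ≤ b + Finsupp.linearCombination ℝ t c) :
    ∃ μ : Measure Ω, IsProbabilityMeasure μ ∧
      ∀ G : Set Ω, IsOpen G → ∀ (b : ℝ) (c : ι →₀ ℝ),
        (∀ y, G.indicator 1 (w y) ≤ b + Finsupp.linearCombination ℝ g c y) →
          μ.real G ≤ b + Finsupp.linearCombination ℝ t c := by
  obtain ⟨Λ, hΛ⟩ := exists_linearMap_extension w g t h
  let Λ' : CompactlySupportedContinuousMap Ω ℝ →ₗ[ℝ] ℝ :=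
    { toFun := fun f => Λ f
      map_add' := fun f f' => Λ.map_add f f'
      map_smul' := fun r f => Λ.map_smul r f }
  let P : CompactlySupportedContinuousMap Ω ℝ →ₚ[ℝ] ℝ := PositiveLinearMap.mk₀ Λ' (by
    intro f hf
    have := hΛ f 0 0 (fun y => by simpa using hf (w y))
    simpa using! this)
  let μ := RealRMK.rieszMeasure P
  have hint (f : C(Ω, ℝ)) : ∫ x, f x ∂μ = Λ f :=
    RealRMK.integral_rieszMeasure P (CompactlySupportedContinuousMap.continuousMapEquiv f)
  have hone : Λ 1 = 1 := by
    have h₁ := hΛ 1 (-1) 0 (fun y => by simp)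
    have h₂ := hΛ (-1) 1 0 (fun y => by simp)
    simp only [map_neg, map_zero, add_zero] at h₁ h₂
    linarith
  have hfin : IsFiniteMeasure μ := inferInstance
  have hprob : IsProbabilityMeasure μ := by
    have h₁ := hint 1
    rw [hone] at h₁
    simp only [ContinuousMap.one_apply, integral_const, smul_eq_mul, mul_one] at h₁
    exact isProbabilityMeasure_iff_real.2 h₁
  refine ⟨μ, hprob, fun G hG b c hGc => ?_⟩
  refine le_of_forall_lt fun r hr => ?_
  rcases lt_or_ge r 0 with hr0 | hr0
  · refine hr0.trans_le (h b c fun y => le_trans ?_ (hGc y))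
    exact Set.indicator_nonneg (by simp) _
  have hr' : ENNReal.ofReal r < μ G := by
    rwa [ENNReal.ofReal_lt_iff_lt_toReal hr0 (measure_ne_top _ _)]
  obtain ⟨K, hKG, hK, hrK⟩ := hG.exists_lt_isCompact hr'
  obtain ⟨f, hf1, hf0, hf01⟩ := exists_continuous_one_zero_of_isCompact hK
    hG.isClosed_compl (Set.disjoint_compl_right_iff_subset.2 hKG)
  have hKf : μ.real K ≤ Λ f := by
    rw [← hint, ← integral_indicator_one hK.measurableSet]
    refine integral_mono ?_ ?_ ?_
    · exact (integrable_const (1 : ℝ)).indicator hK.measurableSet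
    · exact f.continuous.integrable_of_hasCompactSupport (HasCompactSupport.of_compactSpace f)
    · intro x
      by_cases hx : x ∈ K
      · simp [hx, hf1 hx]
      · simpa [hx] using (hf01.2 x).1
  have hfc := hΛ (-f) b c (fun y => by
    have h₁ : f (w y) ≤ G.indicator 1 (w y) := by
      by_cases hy : w y ∈ G
      · simpa [hy] using (hf01.2 (w y)).2
      · simp [hy, hf0 (show w y ∈ Gᶜ from hy)]
    have h₂ := hGc y
    simp only [ContinuousMap.neg_apply]
    linarith)
  rw [ENNReal.ofReal_lt_iff_lt_toReal hr0 (measure_ne_top _ _)] at hrK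
  rw [map_neg] at hfc
  have : r < μ.real K := hrK
  linarith

end Extension

/-! ### Coding closed sets in a Cantor space -/

section Coding

variable {X : Type*} [TopologicalSpace X] [SecondCountableTopology X]

open Classical in
/-- The trace of a closed set on a countable basis: which basic open sets it hits. -/
noncomputable def basisTrace (F : Closeds X) : countableBasis X → Bool :=
  fun U => decide (F ∈ hitting (U : Set X))

/-- The closed set whose complement is the union of the basic open sets labelled `false`. -/
def closedOfTrace (ω : countableBasis X → Bool) : Closeds X where
  carrier := (⋃ (U : countableBasis X) (_ : ω U = false), (U : Set X))ᶜ
  isClosed' := (isOpen_iUnion fun U => isOpen_iUnion fun _ =>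
    isOpen_of_mem_countableBasis U.2).isClosed_compl

theorem mem_closedOfTrace {ω : countableBasis X → Bool} {x : X} :
    x ∈ (closedOfTrace ω : Set X) ↔ ∀ U : countableBasis X, x ∈ (U : Set X) → ω U = true := by
  change x ∈ (⋃ (U : countableBasis X) (_ : ω U = false), (U : Set X))ᶜ ↔ _
  simp only [Set.mem_compl_iff, Set.mem_iUnion, exists_prop, not_exists, not_and']
  simp only [Bool.not_eq_false]

theorem closedOfTrace_basisTrace (F : Closeds X) : closedOfTrace (basisTrace F) = F := by
  refine SetLike.coe_injective (Set.ext fun x => ?_)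
  rw [mem_closedOfTrace]
  simp only [basisTrace, decide_eq_true_eq]
  refine ⟨fun h => ?_, fun hx U hU => ⟨x, hx, hU⟩⟩
  by_contra hx
  obtain ⟨V, hV, hxV, hVF⟩ := (isBasis_countableBasis X).exists_subset_of_mem_open
    (show x ∈ (F : Set X)ᶜ from hx) F.isClosed.isOpen_compl
  obtain ⟨z, hzF, hzV⟩ := h ⟨V, hV⟩ hxV
  exact hVF hzV hzF

/-- If the decoded set misses `K`, finitely many basic sets labelled `false` cover `K`; keeping
these labels is an open condition. -/
theorem isClosed_preimage_closedOfTrace_hitting {K : Set X} (hK : IsCompact K) :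
    IsClosed (closedOfTrace ⁻¹' hitting K) := by
  rw [← isOpen_compl_iff, isOpen_iff_mem_nhds]
  intro ω hω
  have hcover : K ⊆ ⋃ U : {U : countableBasis X // ω U = false},
      ((U : countableBasis X) : Set X) := by
    intro x hx
    by_contra hxU
    refine hω ⟨x, mem_closedOfTrace.2 fun U hU => ?_, hx⟩
    by_contra hωU
    exact hxU (Set.mem_iUnion.2 ⟨⟨U, by simpa using hωU⟩, hU⟩)
  obtain ⟨J, hJ⟩ := hK.elim_finite_subcover _
    (fun U => isOpen_of_mem_countableBasis U.1.2) hcover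
  have hnhds : ∀ᶠ ω' in nhds ω, ∀ U ∈ J, ω' (U : countableBasis X) = false := by
    refine (Filter.eventually_all_finset J).2 fun U _ => ?_
    exact (continuous_apply (U : countableBasis X)).continuousAt.eventually
      ((isOpen_discrete {false}).mem_nhds U.2)
  filter_upwards [hnhds] with ω' hω'
  rintro ⟨x, hx, hxK⟩
  obtain ⟨U, hUJ, hxU⟩ := Set.mem_iUnion₂.1 (hJ hxK)
  have := mem_closedOfTrace.1 hx U hxU
  simp [hω' U hUJ] at this

theorem isRandomClosedSet_closedOfTrace :
    IsRandomClosedSet (closedOfTrace : (countableBasis X → Bool) → Closeds X) := by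
  have : Countable (countableBasis X) := (countable_countableBasis X).to_subtype
  refine @measurable_generateFrom _ _ _ _ _ ?_
  rintro _ ⟨K, hK, rfl⟩
  exact (isClosed_preimage_closedOfTrace_hitting hK).measurableSet

/-- The labellings in which some basic open subset of `B` is labelled `true`. -/
def traceHitting (B : Set X) : Set (countableBasis X → Bool) :=
  {ω | ∃ U : countableBasis X, (U : Set X) ⊆ B ∧ ω U = true}

theorem isOpen_traceHitting (B : Set X) : IsOpen (traceHitting B) := by
  have : traceHitting B = ⋃ (U : countableBasis X) (_ : (U : Set X) ⊆ B),
      (fun ω : countableBasis X → Bool => ω U) ⁻¹' {true} := by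
    ext ω; simp [traceHitting]
  rw [this]
  exact isOpen_iUnion fun U => isOpen_iUnion fun _ =>
    (isOpen_discrete _).preimage (continuous_apply U)

theorem mem_hitting_of_basisTrace_mem {B : Set X} {F : Closeds X}
    (h : basisTrace F ∈ traceHitting B) : F ∈ hitting B := by
  obtain ⟨U, hUB, hU⟩ := h
  simp only [basisTrace, decide_eq_true_eq] at hU
  obtain ⟨x, hxF, hxU⟩ := hU
  exact ⟨x, hxF, hUB hxU⟩

theorem preimage_closedOfTrace_hitting_subset {K B : Set X} (h : K ⊆ interior B) :
    closedOfTrace ⁻¹' hitting K ⊆ traceHitting B := by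
  rintro ω ⟨x, hx, hxK⟩
  obtain ⟨V, hV, hxV, hVB⟩ := (isBasis_countableBasis X).exists_subset_of_mem_open
    (h hxK) isOpen_interior
  exact ⟨⟨V, hV⟩, hVB.trans interior_subset, mem_closedOfTrace.1 hx ⟨V, hV⟩ hxV⟩

end Coding

theorem hitIndicator_comp_eq {X Ω : Type*} [TopologicalSpace X] (ξ : Ω → Closeds X) (K : Set X) :
    (fun ω => hitIndicator K (ξ ω)) = {ω | ((ξ ω : Set X) ∩ K).Nonempty}.indicator 1 :=
  rfl

theorem hitIndicator_of_mem {X : Type*} [TopologicalSpace X] {K : Set X} {F : Closeds X}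
    (h : F ∈ hitting K) : hitIndicator K F = 1 :=
  Set.indicator_of_mem h _

theorem hitIndicator_of_notMem {X : Type*} [TopologicalSpace X] {K : Set X} {F : Closeds X}
    (h : F ∉ hitting K) : hitIndicator K F = 0 :=
  Set.indicator_of_notMem h _

theorem hitIndicator_nonneg {X : Type*} [TopologicalSpace X] (K : Set X) (F : Closeds X) :
    0 ≤ hitIndicator K F :=
  Set.indicator_nonneg (by simp) F

/-! ### Necessity of the conditions -/

section Capacity

variable {X Ω : Type*} [MeasurableSpace Ω] {P : Measure Ω}

theorem IsRandomClosedSet.measurableSet_hitting [TopologicalSpace X] {ξ : Ω → Closeds X}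
    (hξ : IsRandomClosedSet ξ) {K : Set X} (hK : IsCompact K) :
    MeasurableSet {ω | ((ξ ω : Set X) ∩ K).Nonempty} :=
  @Measurable.of_comap_le _ _ _ (effros X) _ (measurable_iff_comap_le.1 hξ) _
    (MeasurableSpace.measurableSet_generateFrom ⟨K, hK, rfl⟩)

theorem closeds_inter_closedBall_nonempty [PseudoMetricSpace X] [ProperSpace X]
    {F : Closeds X} {x : X} {R : ℝ≥0}
    (h : ∀ r > R, ((F : Set X) ∩ Metric.closedBall x r).Nonempty) :
    ((F : Set X) ∩ Metric.closedBall x R).Nonempty := by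
  -- The radius `R + 1` only shows `F` nonempty, so that a nearest point to `x` exists.
  obtain ⟨z, hz, -⟩ := h (R + 1) (by simp)
  obtain ⟨y, hy, hxy⟩ := F.isClosed.exists_infDist_eq_dist ⟨z, hz⟩ x
  refine ⟨y, hy, ?_⟩
  rw [Metric.mem_closedBall, dist_comm, ← coe_nndist, NNReal.coe_le_coe]
  refine le_of_forall_gt_imp_ge_of_dense fun r hr => ?_
  obtain ⟨u, huF, hu⟩ := h r hr
  rw [← NNReal.coe_le_coe, coe_nndist, ← hxy]
  exact (Metric.infDist_le_dist_of_mem huF).trans (by rw [dist_comm]; exact hu)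

theorem continuousWithinAt_capacityFunctional [PseudoMetricSpace X] [ProperSpace X]
    [IsFiniteMeasure P] {ξ : Ω → Closeds X} (hξ : IsRandomClosedSet ξ) (x : X) (R : ℝ≥0) :
    ContinuousWithinAt (fun r : ℝ≥0 => capacityFunctional P ξ (Metric.closedBall x r))
      (Set.Ici R) R := by
  rw [← continuousWithinAt_Ioi_iff_Ici]
  have hlim := tendsto_measure_biInter_gt (μ := P) (a := R)
    (s := fun r : ℝ≥0 => {ω | ((ξ ω : Set X) ∩ Metric.closedBall x r).Nonempty})
    (fun r _ => (hξ.measurableSet_hitting (isCompact_closedBall x r)).nullMeasurableSet)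
    (fun i j _ hij ω hω => hω.mono (Set.inter_subset_inter_right _
      (Metric.closedBall_subset_closedBall (NNReal.coe_le_coe.2 hij))))
    ⟨R + 1, by simp, measure_ne_top _ _⟩
  have hInter : ⋂ r > R, {ω | ((ξ ω : Set X) ∩ Metric.closedBall x r).Nonempty} =
      {ω | ((ξ ω : Set X) ∩ Metric.closedBall x R).Nonempty} := by
    ext ω
    simp only [Set.mem_iInter, Set.mem_ofPred_eq]
    exact ⟨closeds_inter_closedBall_nonempty, fun h r hr =>
      h.mono (Set.inter_subset_inter_right _
        (Metric.closedBall_subset_closedBall (NNReal.coe_le_coe.2 hr.le)))⟩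
  rw [hInter] at hlim
  exact (ENNReal.tendsto_toReal (measure_ne_top _ _)).comp hlim

theorem sum_mul_capacityFunctional_nonneg [TopologicalSpace X] [IsFiniteMeasure P]
    {ξ : Ω → Closeds X} (hξ : IsRandomClosedSet ξ) {κ : Type*} [Fintype κ] (a : κ → ℝ)
    (K : κ → Set X) (hK : ∀ i, IsCompact (K i))
    (h : ∀ F : Closeds X, 0 ≤ ∑ i, a i * hitIndicator (K i) F) :
    0 ≤ ∑ i, a i * capacityFunctional P ξ (K i) := by
  have hint (i : κ) : Integrable (fun ω => hitIndicator (K i) (ξ ω)) P := by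
    rw [hitIndicator_comp_eq]
    exact (integrable_const (1 : ℝ)).indicator (hξ.measurableSet_hitting (hK i))
  have heq : ∑ i, a i * capacityFunctional P ξ (K i) =
      ∫ ω, ∑ i, a i * hitIndicator (K i) (ξ ω) ∂P := by
    rw [integral_finsetSum _ fun i _ => (hint i).const_mul (a i)]
    refine Finset.sum_congr rfl fun i _ => ?_
    rw [integral_const_mul, hitIndicator_comp_eq,
      integral_indicator_one (hξ.measurableSet_hitting (hK i))]
    rfl
  rw [heq]
  exact integral_nonneg fun ω => h (ξ ω)

end Capacity

/-! ### Adjoining the constants -/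

section Positivity

variable {X : Type*} [PseudoMetricSpace X] {A : Set X} {τ : A → ℝ≥0 → ℝ}

/-- Positivity on combinations of hitting indicators of balls, for finitely supported families. -/
theorem linearCombination_nonneg
    (hpos : ∀ (m : ℕ), 1 ≤ m → ∀ (a : Fin m → ℝ) (x : Fin m → A) (R : Fin m → ℝ≥0),
      (∀ F : Closeds X, 0 ≤ ∑ i, a i * hitIndicator (Metric.closedBall (x i : X) (R i)) F) →
        0 ≤ ∑ i, a i * τ (x i) (R i)) (c : A × ℝ≥0 →₀ ℝ)
    (h : ∀ F, 0 ≤ Finsupp.linearCombination ℝ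
      (fun i : A × ℝ≥0 => hitIndicator (Metric.closedBall (i.1 : X) i.2)) c F) :
    0 ≤ Finsupp.linearCombination ℝ (fun i : A × ℝ≥0 => τ i.1 i.2) c := by
  -- Positivity is assumed only for at least one term.
  rcases eq_or_ne c 0 with rfl | hc
  · simp
  let e := c.support.equivFin.symm
  have key (f : A × ℝ≥0 → ℝ) :
      ∑ i, c (e i) * f (e i) = ∑ i ∈ c.support, c i * f i := by
    rw [← Finset.sum_coe_sort c.support]
    exact e.sum_comp fun i => c i * f i
  have := hpos c.support.card (Finset.card_pos.2 (Finsupp.support_nonempty_iff.2 hc))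
    (fun i => c (e i)) (fun i => (e i).1.1) (fun i => (e i).1.2) (fun F => by
      rw [key fun i => hitIndicator (Metric.closedBall (i.1 : X) i.2) F]
      simpa [Finsupp.linearCombination_apply, Finsupp.sum, Finset.sum_apply] using h F)
  rw [key fun i => τ i.1 i.2] at this
  simpa [Finsupp.linearCombination_apply, Finsupp.sum] using this

/-- Positivity passes to combinations of hitting indicators and constants, since the indicator
of a large ball may replace the constant. -/
theorem add_linearCombination_nonneg (hτ : ∀ x R, τ x R ≤ 1)
    (hpos : ∀ (m : ℕ), 1 ≤ m → ∀ (a : Fin m → ℝ) (x : Fin m → A) (R : Fin m → ℝ≥0),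
      (∀ F : Closeds X, 0 ≤ ∑ i, a i * hitIndicator (Metric.closedBall (x i : X) (R i)) F) →
        0 ≤ ∑ i, a i * τ (x i) (R i)) (b : ℝ) (c : A × ℝ≥0 →₀ ℝ)
    (h : ∀ F, 0 ≤ b + Finsupp.linearCombination ℝ
      (fun i : A × ℝ≥0 => hitIndicator (Metric.closedBall (i.1 : X) i.2)) c F) :
    0 ≤ b + Finsupp.linearCombination ℝ (fun i : A × ℝ≥0 => τ i.1 i.2) c := by
  have happly (F : Closeds X) : Finsupp.linearCombination ℝ
      (fun i : A × ℝ≥0 => hitIndicator (Metric.closedBall (i.1 : X) i.2)) c F =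
        ∑ i ∈ c.support, c i * hitIndicator (Metric.closedBall (i.1 : X) i.2) F := by
    simp [Finsupp.linearCombination_apply, Finsupp.sum, Finset.sum_apply]
  -- The empty set hits no ball.
  have hb : 0 ≤ b := by
    have := h ⊥
    rwa [happly, Finset.sum_eq_zero, add_zero] at this
    intro i _
    rw [hitIndicator_of_notMem (by simp [hitting]), mul_zero]
  rcases eq_or_ne c 0 with rfl | hc
  · simpa using hb
  obtain ⟨⟨x₀, -⟩, -⟩ := Finsupp.support_nonempty_iff.2 hc
  -- A sum in place of a maximum: the ball about `x₀` contains all balls involved, so a set missing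
  -- it makes the whole combination vanish.
  let R₀ : ℝ≥0 := ∑ i ∈ c.support, (i.2 + nndist (i.1 : X) x₀)
  have hR₀ : ∀ i ∈ c.support,
      Metric.closedBall (i.1 : X) i.2 ⊆ Metric.closedBall (x₀ : X) R₀ := by
    intro i hi
    refine Metric.closedBall_subset_closedBall' ?_
    rw [← coe_nndist, ← NNReal.coe_add, NNReal.coe_le_coe]
    exact Finset.single_le_sum (f := fun i : A × ℝ≥0 => i.2 + nndist (i.1 : X) x₀)
      (fun _ _ => zero_le) hi
  have h₁ := linearCombination_nonneg hpos (c + Finsupp.single (x₀, R₀) b) (fun F => by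
    rw [map_add, Pi.add_apply, Finsupp.linearCombination_single, Pi.smul_apply, smul_eq_mul]
    by_cases hF : F ∈ hitting (Metric.closedBall (x₀ : X) R₀)
    · rw [hitIndicator_of_mem hF, mul_one, add_comm]
      exact h F
    · rw [hitIndicator_of_notMem hF, mul_zero, add_zero, happly]
      refine (Finset.sum_eq_zero fun i hi => ?_).ge
      rw [hitIndicator_of_notMem, mul_zero]
      exact fun hFi => hF (hFi.mono (Set.inter_subset_inter_right _ (hR₀ i hi))))
  rw [map_add, Finsupp.linearCombination_single, smul_eq_mul] at h₁
  have h₂ := mul_le_of_le_one_right hb (hτ x₀ R₀)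
  linarith

end Positivity

/-- A right-continuous `[0, 1]`-valued family that is positive on the hitting indicators of balls
is realised by a random closed set. -/
theorem isBallRealisable_of_nonneg {d : ℕ} {A : Set (EuclideanSpace ℝ (Fin d))}
    {τ : A → ℝ≥0 → ℝ} (hτ : ∀ x R, τ x R ≤ 1)
    (hcont : ∀ (x : A) (R : ℝ≥0), ContinuousWithinAt (τ x) (Set.Ici R) R)
    (hpos : ∀ (m : ℕ), 1 ≤ m → ∀ (a : Fin m → ℝ) (x : Fin m → A) (R : Fin m → ℝ≥0),
      (∀ F : Closeds (EuclideanSpace ℝ (Fin d)),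
        0 ≤ ∑ i, a i *
          hitIndicator (Metric.closedBall (x i : EuclideanSpace ℝ (Fin d)) (R i)) F) →
        0 ≤ ∑ i, a i * τ (x i) (R i)) :
    IsBallRealisable A τ := by
  let X := EuclideanSpace ℝ (Fin d)
  have : Countable (countableBasis X) := (countable_countableBasis X).to_subtype
  obtain ⟨μ, hμ, hle⟩ := exists_isProbabilityMeasure_open_le
    (basisTrace : Closeds X → countableBasis X → Bool)
    (fun i : A × ℝ≥0 => hitIndicator (Metric.closedBall (i.1 : X) i.2)) (fun i => τ i.1 i.2)
    (add_linearCombination_nonneg hτ hpos)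
  refine ⟨countableBasis X → Bool, inferInstance, μ, closedOfTrace, hμ,
    isRandomClosedSet_closedOfTrace, fun x R => ?_⟩
  have hclosed (R : ℝ≥0) := isClosed_preimage_closedOfTrace_hitting
    (isCompact_closedBall (x : X) (R : ℝ))
  change μ.real (closedOfTrace ⁻¹' hitting (Metric.closedBall (x : X) R)) = τ x R
  refine le_antisymm ?_ ?_
  -- Upper bound: the open event `traceHitting` of a larger ball lies between the two hitting
  -- events; then let `r` decrease to `R`.
  · have hR (r : ℝ≥0) (hr : R < r) :
        μ.real (closedOfTrace ⁻¹' hitting (Metric.closedBall (x : X) R)) ≤ τ x r := by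
      have hsub : Metric.closedBall (x : X) R ⊆ interior (Metric.closedBall (x : X) r) :=
        (Metric.closedBall_subset_ball (NNReal.coe_lt_coe.2 hr)).trans
          Metric.ball_subset_interior_closedBall
      refine (measureReal_mono (preimage_closedOfTrace_hitting_subset hsub)).trans ?_
      have := hle _ (isOpen_traceHitting (Metric.closedBall (x : X) r)) 0
        (Finsupp.single (x, r) 1) (fun F => by
          rw [zero_add, Finsupp.linearCombination_single, one_smul]
          by_cases hF : basisTrace F ∈ traceHitting (Metric.closedBall (x : X) r)
          · rw [Set.indicator_of_mem hF, hitIndicator_of_mem (mem_hitting_of_basisTrace_mem hF)]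
            rfl
          · rw [Set.indicator_of_notMem hF]
            exact hitIndicator_nonneg _ _)
      simpa using this
    exact ge_of_tendsto ((continuousWithinAt_Ioi_iff_Ici.2 (hcont x R)).tendsto)
      (Filter.eventually_of_mem self_mem_nhdsWithin hR)
  -- Lower bound: on codes the open event of missing the ball has indicator at most one minus the
  -- hitting indicator.
  · have := hle _ (hclosed R).isOpen_compl 1 (Finsupp.single (x, R) (-1)) (fun F => by
      rw [Finsupp.linearCombination_single, neg_one_smul, Pi.neg_apply]
      by_cases hF : F ∈ hitting (Metric.closedBall (x : X) R)
      · rw [Set.indicator_of_notMem, hitIndicator_of_mem hF, add_neg_cancel]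
        rw [Set.notMem_compl_iff, Set.mem_preimage, closedOfTrace_basisTrace]
        exact hF
      · rw [hitIndicator_of_notMem hF, neg_zero, add_zero]
        exact Set.indicator_le_self' (by simp) _)
    rw [measureReal_compl (hclosed R).measurableSet, probReal_univ,
      Finsupp.linearCombination_single, smul_eq_mul] at this
    linarith

theorem mainTheorem11 (d : ℕ) (A : Set (EuclideanSpace ℝ (Fin d))) (τ : A → ℝ≥0 → ℝ) :
    IsBallRealisable A τ ↔
      (∀ (x : A) (R : ℝ≥0), τ x R ∈ Set.Icc (0 : ℝ) 1) ∧
      (∀ (x : A) (R : ℝ≥0), ContinuousWithinAt (τ x) (Set.Ici R) R) ∧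
      (∀ (m : ℕ), 1 ≤ m → ∀ (a : Fin m → ℝ) (x : Fin m → A) (R : Fin m → ℝ≥0),
        (∀ F : Closeds (EuclideanSpace ℝ (Fin d)),
          0 ≤ ∑ i, a i *
            hitIndicator (Metric.closedBall (x i : EuclideanSpace ℝ (Fin d)) (R i)) F) →
        0 ≤ ∑ i, a i * τ (x i) (R i)) := by
  refine ⟨?_, fun ⟨hτ, hcont, hpos⟩ =>
    isBallRealisable_of_nonneg (fun x R => (hτ x R).2) hcont hpos⟩
  rintro ⟨Ω, mΩ, P, ξ, hP, hξ, h⟩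
  obtain rfl : (fun (x : A) (R : ℝ≥0) => capacityFunctional P ξ
    (Metric.closedBall (x : EuclideanSpace ℝ (Fin d)) R)) = τ := funext₂ h
  exact ⟨fun x R => ⟨measureReal_nonneg, measureReal_le_one⟩,
    fun x R => continuousWithinAt_capacityFunctional hξ (x : EuclideanSpace ℝ (Fin d)) R,
    fun m _ a x R hF => sum_mul_capacityFunctional_nonneg hξ a _
      (fun i => isCompact_closedBall _ _) hF⟩
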